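/- Let $S_n$ be the group of permutations of $[n]=\{1,\dots,n\}$. A family $\mathcal{A}\subset S_n$ is *intersecting* if for all $\sigma,\pi\in\mathcal{A}$ there is some $i\in[n]$ with $\sigma(i)=\pi(i)$; it is *centred* if there exist $i,j\in[n]$ such that $\sigma(i)=j$ for every $\sigma\in\mathcal{A}$. Let $d_m$ denote the number of derangements (permutations without fixed points) of $[m]$ (so $d_0=1$), and for $n\geq 2$ let $$\mathcal{C}=\mathcal{C}_n=\{\sigma\in S_n:\ \sigma(1)=1,\ \sigma(i)=i \text{ for some } i>2\}\cup\{(1\ 2)\}.$$ There exists $N$ such that the following holds for every $n\geq N$ (with $n\ge 2$). The family $\mathcal{C}$ is a non-centred intersecting family, and $$|\mathcal{C}|=(n-1)!-d_{n-1}-d_{n-2}+1 .$$ If $\mathcal{A}\subset S_n$ is any non-centred intersecting family, then $|\mathcal{A}|\leq|\mathcal{C}|$, and equality holds if and only if $\mathcal{A}$ is a double translate of $\mathcal{C}$, i.e. $\mathcal{A}=\pi\mathcal{C}\tau$ for some $\pi,\tau\in S_n$. Moreover, $|\mathcal{C}_n|=(1-1/e+o(1))(n-1)!$ as $n\to\infty$.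 -/

import Mathlib

namespace CameronKu

open Equiv

/-- A family of permutations of `[n]` is intersecting if any two members agree at some point. -/
def IsIntersecting {n : ℕ} (A : Finset (Perm (Fin n))) : Prop :=
  ∀ σ ∈ A, ∀ π ∈ A, ∃ i, σ i = π i

/-- A family is centred if, for some `i` and `j`, all of its members map `i` to `j`. -/
def IsCentred {n : ℕ} (A : Finset (Perm (Fin n))) : Prop :=
  ∃ i j, ∀ σ ∈ A, σ i = j

/-- The family `{σ : σ(1) = 1, σ(i) = i for some i > 2} ∪ {(1 2)}`. The points `1, 2, …, n` of
`[n]` are the elements `0, 1, …, n - 1` of `Fin n`, so `i > 2` becomes `1 < i`. -/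
def familyC (n : ℕ) (hn : 2 ≤ n) : Finset (Perm (Fin n)) :=
  Finset.univ.filter (fun σ : Perm (Fin n) => σ ⟨0, by omega⟩ = ⟨0, by omega⟩ ∧
      ∃ i : Fin n, 1 < i.val ∧ σ i = i) ∪
    {Equiv.swap ⟨0, by omega⟩ ⟨1, by omega⟩}

/-- `A` is a double translate of `F` if `A = π F τ` for some permutations `π` and `τ`. -/
def IsDoubleTranslate {n : ℕ} (A F : Finset (Perm (Fin n))) : Prop :=
  ∃ π τ : Perm (Fin n), A = F.image (fun σ => π * σ * τ)

end CameronKu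

/-!
Identify a permutation with its graph, a set of `n` points of the `n × n` grid; agreeing somewhere
means that the graphs meet. The key fact about sets is that two sufficiently spread families contain
disjoint members: in a random colouring with four colours, one family has with probability greater
than `1 / 2` a member using only the first two colours, and the other one a member using only the
last two. For one family this follows from a count of minimum fragments, the least possible parts of
its members left uncovered by a colour class. A fragment is determined, up to its position inside a
fixed member, by the colouring in which it has been recoloured, so that large fragments are rare.

Every family of permutations has a spread part around some partial permutation, obtained by
maximizing `r ^ #X` times the number of graphs containing `X`. Removing such parts one after another
approximates an intersecting family by the permutations that extend a member of an intersecting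
family of small partial permutations. If these partial permutations have no common point, then few
permutations extend one of them; otherwise the family is a star `σ i = j` up to at most `(n - 3)!`
permutations.

In the second case a permutation `τ` of the family with `τ i ≠ j` forces the members of the star to
agree somewhere with `τ`, which excludes `d_{n-1} + d_{n-2}` of them. A second such permutation
excludes at least `d_{n-2} ≥ (n - 3)!` more, which is too many to be made up for outside the star.
-/

namespace CameronKu

open Finset Equiv

section Spread

variable {ι U : Type*} [DecidableEq U] {F G : ι → Finset U} {s s' : Finset ι} {r C C' : ℝ}

/-- The family `F`, indexed by `s`, is `r`-spread up to the factor `C`: a set `X` is contained in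
at most a proportion `C / r ^ #X` of the members. For `C = 1` this is the usual notion of an
`r`-spread family; the factor leaves room for passing to subfamilies. Members are counted with
multiplicity. -/
def IsSpread (F : ι → Finset U) (s : Finset ι) (r C : ℝ) : Prop :=
  ∀ X, (#{i ∈ s | X ⊆ F i} : ℝ) * r ^ #X ≤ C * #s

theorem IsSpread.one_le (h : IsSpread F s r C) (hs : s.Nonempty) : 1 ≤ C := by
  have hs₀ : (0 : ℝ) < #s := by exact_mod_cast hs.card_pos
  have := h ∅
  simp only [empty_subset, filter_true, card_empty, pow_zero, mul_one] at this
  exact le_of_mul_le_mul_right (by rwa [one_mul]) hs₀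

theorem IsSpread.mono (h : IsSpread F s r C) (hr : 0 ≤ r) (hs : s' ⊆ s)
    (hG : ∀ i ∈ s', G i ⊆ F i) (hC : C * #s ≤ C' * #s') : IsSpread G s' r C' := by
  refine fun X ↦ le_trans ?_ ((h X).trans hC)
  gcongr
  intro i hi
  rw [mem_filter] at hi ⊢
  exact ⟨hs hi.1, hi.2.trans (hG i hi.1)⟩

theorem IsSpread.card_le_two_mul_card_filter_disjoint (h : IsSpread F s r 1) (hr : 0 < r)
    {Y : Finset U} (hY : 2 * (#Y : ℝ) ≤ r) : #s ≤ 2 * #{i ∈ s | Disjoint (F i) Y} := by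
  classical
  have hsub : {i ∈ s | ¬ Disjoint (F i) Y} ⊆ Y.biUnion fun y ↦ {i ∈ s | {y} ⊆ F i} := by
    intro i hi
    obtain ⟨his, y, hyi, hyY⟩ := by simpa only [mem_filter, not_disjoint_iff] using hi
    exact mem_biUnion.2 ⟨y, hyY, mem_filter.2 ⟨his, singleton_subset_iff.2 hyi⟩⟩
  have hmeet : (#{i ∈ s | ¬ Disjoint (F i) Y} : ℝ) ≤ #s / 2 :=
    calc (#{i ∈ s | ¬ Disjoint (F i) Y} : ℝ) ≤ ∑ y ∈ Y, (#{i ∈ s | {y} ⊆ F i} : ℝ) := by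
          exact_mod_cast (card_le_card hsub).trans card_biUnion_le
      _ ≤ ∑ _y ∈ Y, (#s : ℝ) / r := by
          refine sum_le_sum fun y _ ↦ (le_div_iff₀ hr).2 ?_
          simpa using h {y}
      _ = 2 * #Y * (#s / 2 / r) := by
          rw [sum_const, nsmul_eq_mul]
          ring
      _ ≤ r * (#s / 2 / r) := by gcongr
      _ = #s / 2 := mul_div_cancel₀ _ hr.ne'
  have hsplit : (#{i ∈ s | Disjoint (F i) Y} : ℝ) + #{i ∈ s | ¬ Disjoint (F i) Y} = #s := by
    exact_mod_cast card_filter_add_card_filter_not _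
  have : (#s : ℝ) ≤ 2 * #{i ∈ s | Disjoint (F i) Y} := by linarith
  exact_mod_cast this

theorem exists_isSpread_sdiff [Finite U] (F : ι → Finset U) (hs : s.Nonempty) (hr : 0 < r) :
    ∃ X, {i ∈ s | X ⊆ F i}.Nonempty ∧ IsSpread (fun i ↦ F i \ X) {i ∈ s | X ⊆ F i} r 1 ∧
      (#s : ℝ) ≤ r ^ #X * #{i ∈ s | X ⊆ F i} := by
  cases nonempty_fintype U
  -- A set `X` maximizing `r ^ #X * #{i ∈ s | X ⊆ F i}` works: compare it with `Z ∪ X` and `∅`.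
  obtain ⟨X, -, hmax⟩ := (univ : Finset (Finset U)).exists_max_image
    (fun X ↦ r ^ #X * (#{i ∈ s | X ⊆ F i} : ℝ)) univ_nonempty
  have hle : (#s : ℝ) ≤ r ^ #X * #{i ∈ s | X ⊆ F i} := by simpa using hmax ∅ (mem_univ _)
  have hs₀ : (0 : ℝ) < #s := by exact_mod_cast hs.card_pos
  have hpos : (0 : ℝ) < #{i ∈ s | X ⊆ F i} :=
    pos_of_mul_pos_right (hs₀.trans_le hle) (by positivity)
  refine ⟨X, card_pos.1 (by exact_mod_cast hpos), fun Z ↦ ?_, hle⟩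
  rw [one_mul]
  by_cases hZ : Disjoint Z X
  · have hsub : {i ∈ {i ∈ s | X ⊆ F i} | Z ⊆ F i \ X} ⊆ {i ∈ s | Z ∪ X ⊆ F i} := by
      intro i hi
      simp only [mem_filter] at hi ⊢
      exact ⟨hi.1.1, union_subset (hi.2.trans sdiff_subset) hi.1.2⟩
    refine le_of_mul_le_mul_left ?_ (pow_pos hr #X)
    calc r ^ #X * (#{i ∈ {i ∈ s | X ⊆ F i} | Z ⊆ F i \ X} * r ^ #Z)
        ≤ r ^ #X * (#{i ∈ s | Z ∪ X ⊆ F i} * r ^ #Z) := by gcongr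
      _ = r ^ #(Z ∪ X) * #{i ∈ s | Z ∪ X ⊆ F i} := by
          rw [card_union_of_disjoint hZ, pow_add]
          ring
      _ ≤ r ^ #X * #{i ∈ s | X ⊆ F i} := hmax _ (mem_univ _)
  · rw [filter_false_of_mem fun i _ h ↦ hZ (disjoint_of_subset_left h sdiff_disjoint)]
    simp

end Spread

section Fragment

variable {ι U : Type*} [DecidableEq U] {F : ι → Finset U} {s : Finset ι} {W : Finset U} {i j : ι}

/-- A minimum fragment of `F i` with respect to `W`: a set `F j \ W` of least size among the
members `F j` that are contained in `F i ∪ W`. The index `i` itself is always allowed for `j`, so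
that a minimum exists even when `i ∉ s`. -/
noncomputable def fragment (F : ι → Finset U) (s : Finset ι) (W : Finset U) (i : ι) : Finset U :=
  F (Function.argminOn (fun j ↦ #(F j \ W)) {j ∈ insert i (s : Set ι) | F j ⊆ F i ∪ W}
    ⟨i, Set.mem_insert i _, subset_union_left⟩) \ W

theorem disjoint_fragment : Disjoint (fragment F s W i) W :=
  sdiff_disjoint

theorem exists_fragment_eq_sdiff (hi : i ∈ s) :
    ∃ j ∈ s, F j ⊆ F i ∪ W ∧ fragment F s W i = F j \ W := by
  obtain ⟨hj, hsub⟩ := Function.argminOn_mem (fun j ↦ #(F j \ W))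
    {j ∈ insert i (s : Set ι) | F j ⊆ F i ∪ W} ⟨i, Set.mem_insert i _, subset_union_left⟩
  exact ⟨_, hj.elim (fun h ↦ h.symm ▸ hi) id, hsub, rfl⟩

theorem fragment_subset (hi : i ∈ s) : fragment F s W i ⊆ F i := by
  obtain ⟨j, -, hj, hfrag⟩ := exists_fragment_eq_sdiff (F := F) (W := W) hi
  exact hfrag ▸ sdiff_le_iff.2 (hj.trans (union_comm _ _).subset)

theorem exists_subset_union_fragment (hi : i ∈ s) : ∃ j ∈ s, F j ⊆ W ∪ fragment F s W i := by
  obtain ⟨j, hj, -, hfrag⟩ := exists_fragment_eq_sdiff (F := F) (W := W) hi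
  exact ⟨j, hj, by rw [hfrag, union_sdiff_self_eq_union]; exact subset_union_right⟩

theorem card_fragment_le (hj : j ∈ s) (h : F j ⊆ F i ∪ W) : #(fragment F s W i) ≤ #(F j \ W) :=
  Function.argminOn_le (fun j ↦ #(F j \ W)) {j ∈ insert i (s : Set ι) | F j ⊆ F i ∪ W}
    ⟨Set.mem_insert_of_mem i hj, h⟩

theorem fragment_subset_of_subset (hi : i ∈ s) (hj : j ∈ s) (h : F j ⊆ W ∪ fragment F s W i) :
    fragment F s W i ⊆ F j := by
  have hcard : #(fragment F s W i) ≤ #(F j \ W) :=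
    card_fragment_le hj <| (h.trans (union_subset_union_right (fragment_subset hi))).trans
      (union_comm _ _).subset
  rw [← eq_of_subset_of_card_le (sdiff_le_iff.2 h) hcard]
  exact sdiff_subset

end Fragment

section Colouring

variable {ι U K : Type*} [Fintype U] [DecidableEq K] {F : ι → Finset U}
  {s : Finset ι} {c d : U → K} {a b : K} {i : ι} {r C z : ℝ} {k t : ℕ}

/-- The set of points to which the colouring `c` gives the colour `a`. -/
def colourClass (c : U → K) (a : K) : Finset U :=
  {u | c u = a}

@[simp]
theorem mem_colourClass {u : U} : u ∈ colourClass c a ↔ c u = a := by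
  simp [colourClass]

variable [DecidableEq U]

/-- The colouring obtained from `c` by giving the colour `a` to all points of the minimum fragment
of `F i` with respect to the points that already have this colour. -/
noncomputable def recolour (F : ι → Finset U) (s : Finset ι) (a : K) (c : U → K) (i : ι) : U → K :=
  (fragment F s (colourClass c a) i).piecewise (fun _ ↦ a) c

theorem colourClass_recolour :
    colourClass (recolour F s a c i) a = colourClass c a ∪ fragment F s (colourClass c a) i := by
  ext u
  by_cases h : u ∈ fragment F s (colourClass c a) i <;> simp [recolour, h]

theorem colourClass_recolour_of_ne (hab : a ≠ b)
    (h : Disjoint (fragment F s (colourClass c b) i) (colourClass c a)) :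
    colourClass (recolour F s b c i) a = colourClass c a := by
  ext u
  by_cases hu : u ∈ fragment F s (colourClass c b) i
  · have := disjoint_left.1 h hu
    simp_all [recolour, hab.symm]
  · simp [recolour, hu]

theorem exists_fragment_subset_of_recolour_eq (hs : s.Nonempty) (a : K) (d : U → K) :
    ∃ j ∈ s, ∀ c, ∀ i ∈ s, recolour F s a c i = d → fragment F s (colourClass c a) i ⊆ F j := by
  -- Any member contained in the class of colour `a` of `d` can play the role of `F j`.
  by_cases h : ∃ j ∈ s, F j ⊆ colourClass d a
  · obtain ⟨j, hj, hjd⟩ := h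
    refine ⟨j, hj, fun c i hi hd ↦ fragment_subset_of_subset hi hj ?_⟩
    rwa [← colourClass_recolour, hd]
  · obtain ⟨j, hj⟩ := hs
    refine ⟨j, hj, fun c i hi hd ↦ (h ?_).elim⟩
    rw [← hd, colourClass_recolour]
    exact exists_subset_union_fragment hi

theorem card_filter_forall_notMem_eq [Fintype K] (c : U → K) (T : Finset U) :
    #{d : U → K | ∀ u ∉ T, d u = c u} = Fintype.card K ^ #T := by
  have hpi : ({d : U → K | ∀ u ∉ T, d u = c u} : Finset (U → K)) =
      Fintype.piFinset fun u ↦ if u ∈ T then univ else {c u} := by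
    ext d
    simp only [mem_filter_univ, Fintype.mem_piFinset]
    refine forall_congr' fun u ↦ ?_
    by_cases h : u ∈ T <;> simp [h]
  rw [hpi, Fintype.card_piFinset]
  simp [apply_ite card]

variable {Ω : Finset (U → K)} [Fintype K]

theorem card_filter_recolour_eq_fragment_eq_le (Ω : Finset (U → K)) (d : U → K) (X : Finset U) :
    #{p ∈ Ω ×ˢ s | recolour F s a p.1 p.2 = d ∧ fragment F s (colourClass p.1 a) p.2 = X} ≤
      Fintype.card K ^ #X * #{i ∈ s | X ⊆ F i} := by
  rw [← card_filter_forall_notMem_eq d X, ← card_product]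
  refine card_le_card fun ⟨c, i⟩ hp ↦ ?_
  obtain ⟨⟨-, hi⟩, rfl, rfl⟩ := by simpa only [mem_filter, mem_product] using hp
  refine mem_product.2 ⟨mem_filter_univ _ |>.2 fun u hu ↦ ?_,
    mem_filter.2 ⟨hi, fragment_subset hi⟩⟩
  simp [recolour, hu]

theorem sum_filter_recolour_eq_pow_card_fragment_le (h : IsSpread F s r C) (hs : s.Nonempty)
    (hr : 0 < r) (hz : 0 ≤ z) (hk : ∀ i ∈ s, #(F i) ≤ k) (Ω : Finset (U → K)) (d : U → K) :
    ∑ p ∈ Ω ×ˢ s with recolour F s a p.1 p.2 = d, z ^ #(fragment F s (colourClass p.1 a) p.2) ≤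
      C * #s * (1 + z * Fintype.card K / r) ^ k := by
  obtain ⟨j, hj, hsub⟩ := exists_fragment_subset_of_recolour_eq (F := F) hs a d
  have hmaps : ∀ p ∈ {p ∈ Ω ×ˢ s | recolour F s a p.1 p.2 = d},
      fragment F s (colourClass p.1 a) p.2 ∈ (F j).powerset := by
    intro p hp
    rw [mem_filter, mem_product] at hp
    exact mem_powerset.2 (hsub _ _ hp.1.2 hp.2)
  have hC : 0 ≤ C * #s := mul_nonneg (zero_le_one.trans (h.one_le hs)) (Nat.cast_nonneg _)
  rw [← sum_fiberwise_of_maps_to hmaps]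
  calc _ ≤ ∑ X ∈ (F j).powerset, C * #s * (z * Fintype.card K / r) ^ #X := by
        refine sum_le_sum fun X _ ↦ ?_
        rw [sum_congr rfl fun p hp ↦ by rw [(mem_filter.1 hp).2], sum_const, nsmul_eq_mul,
          filter_filter]
        calc _ ≤ ((Fintype.card K ^ #X * #{i ∈ s | X ⊆ F i} : ℕ) : ℝ) * z ^ #X := by
              gcongr
              exact card_filter_recolour_eq_fragment_eq_le Ω d X
          _ = #{i ∈ s | X ⊆ F i} * r ^ #X * (z * Fintype.card K / r) ^ #X := by
              push_cast
              rw [div_pow, mul_pow]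
              field_simp
          _ ≤ _ := mul_le_mul_of_nonneg_right (h X) (by positivity)
    _ = C * #s * (1 + z * Fintype.card K / r) ^ #(F j) := by
        rw [← mul_sum, add_comm, ← sum_pow_mul_eq_add_pow]
        simp only [one_pow, mul_one]
    _ ≤ _ := by
        gcongr
        · exact le_add_of_nonneg_right (by positivity)
        · exact hk j hj

theorem sum_pow_card_fragment_le (h : IsSpread F s r C) (hr : 0 < r) (hz : 0 ≤ z)
    (hk : ∀ i ∈ s, #(F i) ≤ k) (hΩ : ∀ c ∈ Ω, ∀ i ∈ s, recolour F s a c i ∈ Ω) :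
    ∑ c ∈ Ω, ∑ i ∈ s, z ^ #(fragment F s (colourClass c a) i) ≤
      #Ω * (C * #s * (1 + z * Fintype.card K / r) ^ k) := by
  rcases s.eq_empty_or_nonempty with rfl | hs
  · simp
  -- Group the pairs `(c, i)` by the recoloured colouring. Together with the minimum fragment it
  -- determines `c` up to the colours inside the fragment.
  have hmaps : ∀ p ∈ Ω ×ˢ s, recolour F s a p.1 p.2 ∈ Ω := fun p hp ↦
    hΩ _ (mem_product.1 hp).1 _ (mem_product.1 hp).2
  rw [← sum_product' Ω s fun c i ↦ z ^ #(fragment F s (colourClass c a) i),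
    ← sum_fiberwise_of_maps_to hmaps, ← nsmul_eq_mul, ← sum_const]
  exact sum_le_sum fun d _ ↦ sum_filter_recolour_eq_pow_card_fragment_le h hs hr hz hk Ω d

theorem card_mul_le_of_le_sum_pow_card_fragment {bad : Finset (U → K)} {m : ℝ}
    (h : IsSpread F s r C) (hr : 0 < r) (hz : 0 ≤ z) (hk : ∀ i ∈ s, #(F i) ≤ k)
    (hΩ : ∀ c ∈ Ω, ∀ i ∈ s, recolour F s a c i ∈ Ω) (hbad : bad ⊆ Ω)
    (hm : ∀ c ∈ bad, m ≤ ∑ i ∈ s, z ^ #(fragment F s (colourClass c a) i)) :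
    #bad * m ≤ #Ω * (C * #s * (1 + z * Fintype.card K / r) ^ k) := by
  rw [← nsmul_eq_mul]
  exact (card_nsmul_le_sum _ _ _ hm).trans <| (sum_le_sum_of_subset_of_nonneg hbad
    fun _ _ _ ↦ by positivity).trans (sum_pow_card_fragment_le h hr hz hk hΩ)

theorem card_filter_half_le_card_fragment_lt (h : IsSpread F s r C) (hs : s.Nonempty) (hr : 0 < r)
    (hk : ∀ i ∈ s, #(F i) ≤ k) (ht : 8 * C * (1 + 2 * Fintype.card K / r) ^ k < 2 ^ t) (a : K) :
    4 * #{c : U → K | #s < 2 * #{i ∈ s | t ≤ #(fragment F s (colourClass c a) i)}} <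
      Fintype.card (U → K) := by
  set bad := ({c | #s < 2 * #{i ∈ s | t ≤ #(fragment F s (colourClass c a) i)}} :
    Finset (U → K))
  have hs₀ : (0 : ℝ) < #s := by exact_mod_cast hs.card_pos
  have hmarkov := card_mul_le_of_le_sum_pow_card_fragment (m := #s / 2 * 2 ^ t) (a := a) h hr
    zero_le_two hk (fun _ _ _ _ ↦ mem_univ _) (subset_univ bad) fun c hc ↦ by
      have hhalf : (#s : ℝ) < 2 * #{i ∈ s | t ≤ #(fragment F s (colourClass c a) i)} := by
        exact_mod_cast (mem_filter.1 hc).2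
      calc (#s : ℝ) / 2 * 2 ^ t
          ≤ #{i ∈ s | t ≤ #(fragment F s (colourClass c a) i)} * 2 ^ t := by
            gcongr
            linarith
        _ ≤ ∑ i ∈ s with t ≤ #(fragment F s (colourClass c a) i),
              2 ^ #(fragment F s (colourClass c a) i) := by
            rw [← nsmul_eq_mul]
            exact card_nsmul_le_sum _ _ _ fun i hi ↦
              pow_le_pow_right₀ one_le_two (mem_filter.1 hi).2
        _ ≤ _ := sum_le_sum_of_subset_of_nonneg (filter_subset _ _) fun _ _ _ ↦ by positivity
  have : Nonempty (U → K) := ⟨fun _ ↦ a⟩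
  have hN : (0 : ℝ) < Fintype.card (U → K) := by exact_mod_cast Fintype.card_pos
  suffices (4 * #bad : ℝ) * (2 ^ t * #s) < Fintype.card (U → K) * (2 ^ t * #s) by
    exact_mod_cast lt_of_mul_lt_mul_right this (mul_pos (by positivity) hs₀).le
  calc (4 * #bad : ℝ) * (2 ^ t * #s) = 8 * (#bad * (#s / 2 * 2 ^ t)) := by ring
    _ ≤ 8 * (Fintype.card (U → K) * (C * #s * (1 + 2 * Fintype.card K / r) ^ k)) := by
        rw [card_univ] at hmarkov
        gcongr
    _ = Fintype.card (U → K) * (8 * C * (1 + 2 * Fintype.card K / r) ^ k * #s) := by ring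
    _ < _ := mul_lt_mul_of_pos_left (mul_lt_mul_of_pos_right ht hs₀) hN

theorem card_filter_forall_not_subset_colourClass_le {W : Finset U} (h : IsSpread F s r C)
    (hs : s.Nonempty) (hr : 0 < r) (hk : ∀ i ∈ s, #(F i) ≤ k)
    (hW : ∀ i ∈ s, Disjoint (F i) W) (hab : a ≠ b)
    (ht : (1 + 8 * C * Fintype.card K / r) ^ k ≤ 2) :
    4 * #{c : U → K | colourClass c a = W ∧ ∀ i ∈ s, ¬ F i ⊆ colourClass c b} ≤
      #{c : U → K | colourClass c a = W} := by
  set Ω := ({c | colourClass c a = W} : Finset (U → K)) with hΩ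
  set bad := ({c | colourClass c a = W ∧ ∀ i ∈ s, ¬ F i ⊆ colourClass c b} : Finset (U → K))
  have hs₀ : (0 : ℝ) < #s := by exact_mod_cast hs.card_pos
  have hC : 0 < C := zero_lt_one.trans_le (h.one_le hs)
  have hstable : ∀ c ∈ Ω, ∀ i ∈ s, recolour F s b c i ∈ Ω := by
    simp only [hΩ, mem_filter_univ]
    rintro c rfl i hi
    exact colourClass_recolour_of_ne hab (disjoint_of_subset_left (fragment_subset hi) (hW i hi))
  have hmarkov := card_mul_le_of_le_sum_pow_card_fragment (z := 8 * C) (m := #s * (8 * C)) h hr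
    (by positivity) hk hstable (monotone_filter_right univ fun c _ hc ↦ hc.1 : bad ⊆ Ω)
    fun c hc ↦ by
      rw [← nsmul_eq_mul]
      refine card_nsmul_le_sum _ _ _ fun i hi ↦
        le_self_pow₀ (by linarith [h.one_le hs]) fun hfrag ↦ ?_
      obtain ⟨j, hj, hsub⟩ := exists_subset_union_fragment (F := F) (W := colourClass c b) hi
      rw [card_eq_zero.1 hfrag, union_empty] at hsub
      exact (mem_filter.1 hc).2.2 j hj hsub
  suffices (4 * #bad : ℝ) * (2 * (#s * C)) ≤ #Ω * (2 * (#s * C)) by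
    exact_mod_cast le_of_mul_le_mul_right this (by positivity)
  calc (4 * #bad : ℝ) * (2 * (#s * C)) = #bad * (#s * (8 * C)) := by ring
    _ ≤ #Ω * (C * #s * (1 + 8 * C * Fintype.card K / r) ^ k) := hmarkov
    _ ≤ #Ω * (C * #s * 2) := by gcongr
    _ = #Ω * (2 * (#s * C)) := by ring

theorem card_filter_colourClass_eq_forall_not_subset_le {W : Finset U} (h : IsSpread F s r C)
    (hs : s.Nonempty) (hr : 0 < r) (hab : a ≠ b)
    (hW : 2 * #{i ∈ s | t ≤ #(fragment F s W i)} ≤ #s)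
    (ht : (1 + 16 * C * Fintype.card K / r) ^ t ≤ 2) :
    4 * #{c : U → K | colourClass c a = W ∧ ∀ i ∈ s, ¬ F i ⊆ W ∪ colourClass c b} ≤
      #{c : U → K | colourClass c a = W} := by
  set s' := {i ∈ s | ¬ t ≤ #(fragment F s W i)}
  have hsub : s' ⊆ s := filter_subset _ _
  have hcard : #{i ∈ s | t ≤ #(fragment F s W i)} + #s' = #s := card_filter_add_card_filter_not _
  have hle : #s ≤ 2 * #s' := by lia
  have hs'₀ : s'.Nonempty := card_pos.1 <| by
    have := hs.card_pos
    lia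
  have hC : 0 ≤ C := zero_le_one.trans (h.one_le hs)
  have hspread : IsSpread (fragment F s W) s' r (2 * C) := by
    refine h.mono hr.le hsub (fun i hi ↦ fragment_subset (hsub hi)) ?_
    have : (#s : ℝ) ≤ 2 * #s' := by exact_mod_cast hle
    calc C * #s ≤ C * (2 * #s') := by gcongr
      _ = 2 * C * #s' := by ring
  refine le_trans ?_ (card_filter_forall_not_subset_colourClass_le hspread hs'₀ hr
    (fun i hi ↦ (not_le.1 (mem_filter.1 hi).2).le) (fun _ _ ↦ disjoint_fragment) hab
    (by rwa [← mul_assoc (8 : ℝ), show (8 : ℝ) * 2 = 16 by norm_num]))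
  gcongr 4 * #?_
  refine monotone_filter_right univ fun c _ ⟨hc, hbad⟩ ↦ ⟨hc, fun i hi hfrag ↦ ?_⟩
  obtain ⟨j, hj, hFj⟩ := exists_subset_union_fragment (F := F) (W := W) (hsub hi)
  exact hbad j hj (hFj.trans (union_subset_union_right hfrag))

theorem two_mul_card_filter_forall_not_subset_lt (h : IsSpread F s r C) (hs : s.Nonempty)
    (hr : 0 < r) (hk : ∀ i ∈ s, #(F i) ≤ k) (hab : a ≠ b)
    (ht : 8 * C * (1 + 2 * Fintype.card K / r) ^ k < 2 ^ t)
    (ht' : (1 + 16 * C * Fintype.card K / r) ^ t ≤ 2) :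
    2 * #{c : U → K | ∀ i ∈ s, ¬ F i ⊆ colourClass c a ∪ colourClass c b} <
      Fintype.card (U → K) := by
  set P : Finset U → Prop := fun W ↦ #s < 2 * #{i ∈ s | t ≤ #(fragment F s W i)}
  set bad : Finset (U → K) := {c | ∀ i ∈ s, ¬ F i ⊆ colourClass c a ∪ colourClass c b}
  have hfirst : 4 * #{c ∈ bad | P (colourClass c a)} < Fintype.card (U → K) :=
    (Nat.mul_le_mul_left 4 (card_le_card (filter_subset_filter _ (subset_univ _)))).trans_lt
      (card_filter_half_le_card_fragment_lt h hs hr hk ht a)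
  have hsecond : 4 * #{c ∈ bad | ¬ P (colourClass c a)} ≤ Fintype.card (U → K) := by
    rw [← card_univ, card_eq_sum_card_fiberwise (f := (colourClass · a)) (t := univ) (by simp),
      card_eq_sum_card_fiberwise (f := (colourClass · a)) (t := univ) (by simp), mul_sum]
    refine sum_le_sum fun W _ ↦ ?_
    by_cases hW : P W
    · have hempty : {c ∈ {c ∈ bad | ¬ P (colourClass c a)} | colourClass c a = W} = ∅ :=
        filter_false_of_mem fun c hc hcW ↦ (mem_filter.1 hc).2 (hcW ▸ hW)
      simp [hempty]
    · refine le_trans ?_ (card_filter_colourClass_eq_forall_not_subset_le h hs hr hab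
        (not_lt.1 hW) ht')
      gcongr 4 * #?_
      intro c hc
      obtain ⟨hcbad, rfl⟩ := mem_filter.1 hc
      exact (mem_filter_univ c).2 ⟨rfl, (mem_filter.1 (mem_filter.1 hcbad).1).2⟩
  have hsplit : #{c ∈ bad | P (colourClass c a)} + #{c ∈ bad | ¬ P (colourClass c a)} = #bad :=
    card_filter_add_card_filter_not _
  lia

end Colouring

section SpreadApproximation

variable {ι κ U : Type*} {F : ι → Finset U} {G : κ → Finset U} {s s₁ s₂ : Finset ι}
  {s' : Finset κ} {X Y : Finset U} {r R C : ℝ} {k t q D : ℕ}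

theorem exists_disjoint_of_isSpread [DecidableEq U] [Finite U] (hF : IsSpread F s r C)
    (hG : IsSpread G s' r C) (hs : s.Nonempty) (hs' : s'.Nonempty) (hr : 0 < r)
    (hFk : ∀ i ∈ s, #(F i) ≤ k) (hGk : ∀ i ∈ s', #(G i) ≤ k)
    (ht : 8 * C * (1 + 8 / r) ^ k < 2 ^ t) (ht' : (1 + 64 * C / r) ^ t ≤ 2) :
    ∃ i ∈ s, ∃ j ∈ s', Disjoint (F i) (G j) := by
  cases nonempty_fintype U
  -- Under some colouring with four colours, `F` has a member with colours `0`, `1` only and `G` one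
  -- with colours `2`, `3` only.
  have ht₄ : 8 * C * (1 + 2 * Fintype.card (Fin 4) / r) ^ k < 2 ^ t := by
    convert ht using 5
    norm_num
  have ht₄' : (1 + 16 * C * Fintype.card (Fin 4) / r) ^ t ≤ 2 := by
    convert ht' using 4
    rw [Fintype.card_fin]
    push_cast
    ring
  have hFbad := two_mul_card_filter_forall_not_subset_lt (a := (0 : Fin 4)) (b := 1) hF hs hr hFk
    (by decide) ht₄ ht₄'
  have hGbad := two_mul_card_filter_forall_not_subset_lt (a := (2 : Fin 4)) (b := 3) hG hs' hr hGk
    (by decide) ht₄ ht₄'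
  obtain ⟨c, -, hc⟩ := exists_mem_notMem_of_card_lt_card (s :=
    ({c : U → Fin 4 | ∀ i ∈ s, ¬ F i ⊆ colourClass c 0 ∪ colourClass c 1} : Finset _) ∪
      ({c : U → Fin 4 | ∀ i ∈ s', ¬ G i ⊆ colourClass c 2 ∪ colourClass c 3} : Finset _))
    (t := univ) ((card_union_le _ _).trans_lt (by rw [card_univ]; lia))
  simp only [mem_union, mem_filter_univ, not_or, not_forall, not_not, exists_prop] at hc
  obtain ⟨⟨i, hi, hic⟩, j, hj, hjc⟩ := hc
  refine ⟨i, hi, j, hj, disjoint_left.2 fun u hui huj ↦ ?_⟩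
  have h₀₁ := hic hui
  have h₂₃ := hjc huj
  simp only [mem_union, mem_colourClass] at h₀₁ h₂₃
  lia

theorem exists_disjoint_of_isSpread_sdiff [DecidableEq U] [Finite U]
    (h₁ : IsSpread (fun i ↦ F i \ X) s₁ r 1) (h₂ : IsSpread (fun i ↦ F i \ Y) s₂ r 1)
    (hs₁ : s₁.Nonempty) (hs₂ : s₂.Nonempty) (hXY : Disjoint X Y) (hr : 0 < r)
    (hX : 2 * (#X : ℝ) ≤ r) (hY : 2 * (#Y : ℝ) ≤ r) (hk₁ : ∀ i ∈ s₁, #(F i) ≤ k)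
    (hk₂ : ∀ i ∈ s₂, #(F i) ≤ k) (ht : 16 * (1 + 8 / r) ^ k < 2 ^ t)
    (ht' : (1 + 128 / r) ^ t ≤ 2) :
    ∃ i ∈ s₁, ∃ j ∈ s₂, Disjoint (F i) (F j) := by
  -- Half of the sets `F i \ X` avoid `Y`, so these still form a spread family; likewise for `Y`.
  have hhalf₁ := h₁.card_le_two_mul_card_filter_disjoint hr hY
  have hhalf₂ := h₂.card_le_two_mul_card_filter_disjoint hr hX
  have hpos₁ := hs₁.card_pos
  have hpos₂ := hs₂.card_pos
  obtain ⟨i, hi, j, hj, hij⟩ := exists_disjoint_of_isSpread (C := 2) (k := k) (t := t)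
    (h₁.mono hr.le (filter_subset _ _) (fun _ _ ↦ Subset.rfl)
      (by rw [one_mul]; exact_mod_cast hhalf₁))
    (h₂.mono hr.le (filter_subset _ _) (fun _ _ ↦ Subset.rfl)
      (by rw [one_mul]; exact_mod_cast hhalf₂))
    (card_pos.1 (by lia)) (card_pos.1 (by lia)) hr
    (fun i hi ↦ (card_le_card sdiff_subset).trans (hk₁ i (mem_filter.1 hi).1))
    (fun i hi ↦ (card_le_card sdiff_subset).trans (hk₂ i (mem_filter.1 hi).1))
    (by norm_num [ht]) (by norm_num [ht'])
  rw [mem_filter] at hi hj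
  refine ⟨i, hi.1, j, hj.1, disjoint_left.2 fun u hui huj ↦ ?_⟩
  have hXu : u ∈ X → u ∉ Y := fun h h' ↦ disjoint_left.1 hXY h h'
  have hiY : u ∉ X → u ∉ Y := fun h ↦ disjoint_left.1 hi.2 (mem_sdiff.2 ⟨hui, h⟩)
  have hjX : u ∉ Y → u ∉ X := fun h ↦ disjoint_left.1 hj.2 (mem_sdiff.2 ⟨huj, h⟩)
  have hne : u ∉ X → u ∈ Y := fun h ↦ by
    simpa [huj] using disjoint_left.1 hij (mem_sdiff.2 ⟨hui, h⟩)
  tauto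

theorem exists_spread_approximation [DecidableEq U] [Finite U]
    (hs : ∀ i ∈ s, ∀ j ∈ s, ¬ Disjoint (F i) (F j)) (hk : ∀ i ∈ s, #(F i) ≤ k) (hr : 0 < r)
    (hR : 0 ≤ R) (hq : 2 * (q : ℝ) ≤ r)
    (hrem : ∀ X, q < #X → r ^ #X * (#{i ∈ s | X ⊆ F i} : ℝ) ≤ R)
    (ht : 16 * (1 + 8 / r) ^ k < 2 ^ t) (ht' : (1 + 128 / r) ^ t ≤ 2) :
    ∃ S : Finset (Finset U), (S : Set (Finset U)).Intersecting ∧ (∀ X ∈ S, #X ≤ q) ∧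
      (#{i ∈ s | ∀ X ∈ S, ¬ X ⊆ F i} : ℝ) ≤ R := by
  have hfin := Set.toFinite
    {X | #X ≤ q ∧ ∃ s' ⊆ s, s'.Nonempty ∧ IsSpread (fun i ↦ F i \ X) s' r 1}
  refine ⟨hfin.toFinset, ?_, fun X hX ↦ (hfin.mem_toFinset.1 hX).1, ?_⟩
  · intro X hX Y hY hXY
    obtain ⟨hXq, s₁, hs₁, hs₁₀, h₁⟩ := hfin.mem_toFinset.1 hX
    obtain ⟨hYq, s₂, hs₂, hs₂₀, h₂⟩ := hfin.mem_toFinset.1 hY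
    have hXr : 2 * (#X : ℝ) ≤ r := le_trans (by gcongr) hq
    have hYr : 2 * (#Y : ℝ) ≤ r := le_trans (by gcongr) hq
    obtain ⟨i, hi, j, hj, hij⟩ := exists_disjoint_of_isSpread_sdiff h₁ h₂ hs₁₀ hs₂₀ hXY hr hXr hYr
      (fun i hi ↦ hk i (hs₁ hi)) (fun i hi ↦ hk i (hs₂ hi)) ht ht'
    exact hs i (hs₁ hi) j (hs₂ hj) hij
  · set s₀ := {i ∈ s | ∀ X ∈ hfin.toFinset, ¬ X ⊆ F i}
    rcases s₀.eq_empty_or_nonempty with h₀ | h₀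
    · simpa [h₀] using hR
    -- The remaining members contain a spread part around some `X`, which must be large.
    obtain ⟨X, ⟨i, hi⟩, hX, hle⟩ := exists_isSpread_sdiff F h₀ hr
    have hsub : {i ∈ s₀ | X ⊆ F i} ⊆ {i ∈ s | X ⊆ F i} :=
      filter_subset_filter _ (filter_subset _ _)
    have hXq : q < #X := by
      by_contra! hXq
      exact (mem_filter.1 (mem_filter.1 hi).1).2 X (hfin.mem_toFinset.2
        ⟨hXq, _, hsub.trans (filter_subset _ _), ⟨i, hi⟩, hX⟩) (mem_filter.1 hi).2
    exact hle.trans (le_trans (by gcongr) (hrem X hXq))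

theorem card_filter_exists_subset_le [DecidableEq U] {S : Finset (Finset U)}
    (hS : (S : Set (Finset U)).Intersecting) (hcommon : ∀ p, ∃ X ∈ S, p ∉ X)
    (hq : ∀ X ∈ S, #X ≤ q) (hD : ∀ x y, x ≠ y → #{i ∈ s | x ∈ F i ∧ y ∈ F i} ≤ D) :
    #{i ∈ s | ∃ X ∈ S, X ⊆ F i} ≤ q ^ 2 * D := by
  classical
  rcases S.eq_empty_or_nonempty with rfl | ⟨X₀, hX₀⟩
  · simp
  choose Y hYS hY using hcommon
  -- A member of `S` meets `X₀` in some `x`, and it meets `Y x` in some `y ≠ x`.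
  have hcover : {i ∈ s | ∃ X ∈ S, X ⊆ F i} ⊆
      X₀.biUnion fun x ↦ (Y x).biUnion fun y ↦ {i ∈ s | x ∈ F i ∧ y ∈ F i} := by
    intro i hi
    obtain ⟨his, X, hX, hXi⟩ := mem_filter.1 hi
    obtain ⟨x, hxX, hx⟩ := not_disjoint_iff.1 (hS hX hX₀)
    obtain ⟨y, hyX, hy⟩ := not_disjoint_iff.1 (hS hX (hYS x))
    exact mem_biUnion.2 ⟨x, hx, mem_biUnion.2 ⟨y, hy, mem_filter.2 ⟨his, hXi hxX, hXi hyX⟩⟩⟩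
  calc _ ≤ #X₀ * (q * D) := by
        refine (card_le_card hcover).trans (card_biUnion_le_card_mul _ _ _ fun x _ ↦ ?_)
        refine (card_biUnion_le_card_mul _ _ D fun y hy ↦ hD x y ?_).trans ?_
        · exact (ne_of_mem_of_not_mem hy (hY x)).symm
        · exact Nat.mul_le_mul_right D (hq _ (hYS x))
    _ ≤ q * (q * D) := Nat.mul_le_mul_right _ (hq X₀ hX₀)
    _ = q ^ 2 * D := by ring

theorem exists_card_filter_notMem_le_or_card_le [DecidableEq U] [Finite U]
    (hs : ∀ i ∈ s, ∀ j ∈ s, ¬ Disjoint (F i) (F j)) (hk : ∀ i ∈ s, #(F i) ≤ k) (hr : 0 < r)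
    (hR : 0 ≤ R) (hq : 2 * (q : ℝ) ≤ r)
    (hrem : ∀ X, q < #X → r ^ #X * (#{i ∈ s | X ⊆ F i} : ℝ) ≤ R)
    (hD : ∀ x y, x ≠ y → #{i ∈ s | x ∈ F i ∧ y ∈ F i} ≤ D)
    (ht : 16 * (1 + 8 / r) ^ k < 2 ^ t) (ht' : (1 + 128 / r) ^ t ≤ 2) :
    (∃ p, (#{i ∈ s | p ∉ F i} : ℝ) ≤ R) ∨ (#s : ℝ) ≤ q ^ 2 * D + R := by
  obtain ⟨S, hS, hSq, hSR⟩ := exists_spread_approximation hs hk hr hR hq hrem ht ht'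
  by_cases! hcommon : ∃ p, ∀ X ∈ S, p ∈ X
  · obtain ⟨p, hp⟩ := hcommon
    refine .inl ⟨p, le_trans ?_ hSR⟩
    gcongr with i
    exact fun hi X hX hXi ↦ hi (hXi (hp X hX))
  · right
    have hcover : (#{i ∈ s | ∃ X ∈ S, X ⊆ F i} : ℝ) ≤ q ^ 2 * D := by
      exact_mod_cast card_filter_exists_subset_le hS hcommon hSq hD
    have hsplit : (#{i ∈ s | ∃ X ∈ S, X ⊆ F i} : ℝ) + #{i ∈ s | ∀ X ∈ S, ¬ X ⊆ F i} = #s := by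
      have := card_filter_add_card_filter_not (s := s) fun i ↦ ∃ X ∈ S, X ⊆ F i
      push Not at this
      exact_mod_cast this
    linarith

end SpreadApproximation

section Graph

variable {α : Type*} [Fintype α] [DecidableEq α]

/-- The graph of a permutation. Two permutations agree at some point if and only if their graphs
meet, so that an intersecting family becomes an intersecting family of sets. -/
def graph (σ : Perm α) : Finset (α × α) :=
  {p | σ p.1 = p.2}

@[simp]
theorem mem_graph {σ : Perm α} {p : α × α} : p ∈ graph σ ↔ σ p.1 = p.2 := by
  simp [graph]

theorem card_graph (σ : Perm α) : #(graph σ) = Fintype.card α := by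
  have himage : graph σ = univ.image fun x ↦ (x, σ x) := by
    ext ⟨x, y⟩
    simp
  rw [himage, card_image_of_injective _ fun x y h ↦ congrArg Prod.fst h, card_univ]

theorem not_disjoint_graph_iff {σ π : Perm α} :
    ¬ Disjoint (graph σ) (graph π) ↔ ∃ x, σ x = π x := by
  simp [not_disjoint_iff, eq_comm]

theorem card_filter_eqOn (σ : Perm α) (D : Finset α) :
    #{π : Perm α | ∀ x ∈ D, π x = σ x} = (Fintype.card α - #D).factorial := by
  have hfix : #{π : Perm α | ∀ x ∈ D, π x = σ x} = #{π : Perm α | ∀ x, ¬ x ∉ D → π x = x} :=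
    card_equiv (Equiv.mulLeft σ⁻¹) fun π ↦ by simp [Equiv.symm_apply_eq]
  rw [hfix, ← Fintype.card_subtype, ← Fintype.card_congr (Perm.subtypeEquivSubtypePerm (· ∉ D)),
    Fintype.card_perm, Fintype.card_subtype_compl, Fintype.card_coe]

theorem card_filter_subset_graph_le {A : Finset (Perm α)} {X : Finset (α × α)}
    (h : {σ ∈ A | X ⊆ graph σ}.Nonempty) :
    #X ≤ Fintype.card α ∧ #{σ ∈ A | X ⊆ graph σ} ≤ (Fintype.card α - #X).factorial := by
  obtain ⟨σ, hσ⟩ := h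
  have hX := (mem_filter.1 hσ).2
  refine ⟨(card_le_card hX).trans (card_graph σ).le, ?_⟩
  have hinj : Set.InjOn Prod.fst (X : Set (α × α)) := fun p hp p' hp' h ↦
    Prod.ext h (by rw [← mem_graph.1 (hX hp), ← mem_graph.1 (hX hp'), h])
  rw [← card_image_of_injOn hinj, ← card_filter_eqOn σ]
  refine card_le_card fun π hπ ↦ (mem_filter_univ π).2 ?_
  rw [forall_mem_image]
  exact fun p hp ↦ (mem_graph.1 ((mem_filter.1 hπ).2 hp)).trans (mem_graph.1 (hX hp)).symm

theorem exists_card_filter_apply_ne_le_or_card_le {A : Finset (Perm α)}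
    (hA : ∀ σ ∈ A, ∀ π ∈ A, ∃ x, σ x = π x) {r R : ℝ} {q t : ℕ} (hr : 0 < r) (hR : 0 ≤ R)
    (hq : 2 * (q : ℝ) ≤ r)
    (hrem : ∀ k, q < k → k ≤ Fintype.card α → r ^ k * ((Fintype.card α - k).factorial : ℝ) ≤ R)
    (ht : 16 * (1 + 8 / r) ^ Fintype.card α < 2 ^ t) (ht' : (1 + 128 / r) ^ t ≤ 2) :
    (∃ i j, (#{σ ∈ A | σ i ≠ j} : ℝ) ≤ R) ∨
      (#A : ℝ) ≤ q ^ 2 * (Fintype.card α - 2).factorial + R := by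
  have hcount : ∀ X, q < #X → r ^ #X * (#{σ ∈ A | X ⊆ graph σ} : ℝ) ≤ R := by
    intro X hX
    rcases {σ ∈ A | X ⊆ graph σ}.eq_empty_or_nonempty with h₀ | h₀
    · simpa [h₀] using hR
    · obtain ⟨hcard, hle⟩ := card_filter_subset_graph_le h₀
      exact le_trans (by gcongr) (hrem _ hX hcard)
  have hpair : ∀ x y, x ≠ y →
      #{σ ∈ A | x ∈ graph σ ∧ y ∈ graph σ} ≤ (Fintype.card α - 2).factorial := by
    intro x y hxy
    simp only [← singleton_subset_iff (a := y), ← insert_subset_iff]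
    rcases {σ ∈ A | {x, y} ⊆ graph σ}.eq_empty_or_nonempty with h₀ | h₀
    · simp [h₀]
    · simpa only [card_pair hxy] using (card_filter_subset_graph_le h₀).2
  refine (exists_card_filter_notMem_le_or_card_le (fun σ hσ π hπ ↦ not_disjoint_graph_iff.2
    (hA σ hσ π hπ)) (fun σ _ ↦ (card_graph σ).le) hr hR hq hcount hpair ht ht').imp_left ?_
  rintro ⟨⟨i, j⟩, h⟩
  exact ⟨i, j, by simpa only [mem_graph] using h⟩

end Graph

section Bounds

theorem pow_mul_factorial_le_pow_mul_descFactorial {n k : ℕ} (hk : k ≤ n) :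
    n ^ k * k.factorial ≤ k ^ k * n.descFactorial k := by
  rw [← Nat.descFactorial_self k, Nat.descFactorial_eq_prod_range, Nat.descFactorial_eq_prod_range,
    pow_eq_prod_const, pow_eq_prod_const, ← prod_mul_distrib, ← prod_mul_distrib]
  refine prod_le_prod' fun i hi ↦ ?_
  obtain ⟨c, rfl⟩ := Nat.exists_eq_add_of_le (mem_range.1 hi).le
  obtain ⟨d, rfl⟩ := Nat.exists_eq_add_of_le hk
  rw [show i + c - i = c by lia, show i + c + d - i = c + d by lia]
  nlinarith [Nat.zero_le (i * d)]

theorem pow_self_le_three_pow_mul_factorial (k : ℕ) : k ^ k ≤ 3 ^ k * k.factorial := by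
  have hexp := Real.pow_div_factorial_le_exp (k : ℝ) (Nat.cast_nonneg k) k
  rw [div_le_iff₀ (by positivity), ← Real.exp_one_pow] at hexp
  have : (k : ℝ) ^ k ≤ 3 ^ k * k.factorial := hexp.trans <| by
    gcongr
    exact Real.exp_one_lt_three.le
  exact_mod_cast this

theorem pow_le_three_pow_mul_descFactorial {n k : ℕ} (hk : k ≤ n) :
    n ^ k ≤ 3 ^ k * n.descFactorial k := by
  refine Nat.le_of_mul_le_mul_right ?_ k.factorial_pos
  calc n ^ k * k.factorial ≤ k ^ k * n.descFactorial k :=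
        pow_mul_factorial_le_pow_mul_descFactorial hk
    _ ≤ 3 ^ k * k.factorial * n.descFactorial k := by
        gcongr
        exact pow_self_le_three_pow_mul_factorial k
    _ = 3 ^ k * n.descFactorial k * k.factorial := by ring

theorem div_six_pow_mul_factorial_sub_le {n k l : ℕ} (hk : k ≤ n) (hl : l ≤ n)
    (hlk : n ^ l ≤ 2 ^ k) :
    ((n : ℝ) / 6) ^ k * (n - k).factorial ≤ (n - l).factorial := by
  have hfac : n ^ k * (n - k).factorial ≤ 3 ^ k * (n ^ l * (n - l).factorial) :=
    calc n ^ k * (n - k).factorial ≤ 3 ^ k * n.descFactorial k * (n - k).factorial := by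
          gcongr
          exact pow_le_three_pow_mul_descFactorial hk
      _ = 3 ^ k * ((n - l).factorial * n.descFactorial l) := by
          rw [Nat.factorial_mul_descFactorial hl, ← Nat.factorial_mul_descFactorial hk]
          ring
      _ ≤ 3 ^ k * ((n - l).factorial * n ^ l) := by
          gcongr
          exact Nat.descFactorial_le_pow n l
      _ = 3 ^ k * (n ^ l * (n - l).factorial) := by ring
  have hfac' : (n : ℝ) ^ k * (n - k).factorial ≤ 3 ^ k * (2 ^ k * (n - l).factorial) := by
    exact_mod_cast hfac.trans (by gcongr)
  rw [div_pow, div_mul_eq_mul_div, div_le_iff₀ (by positivity)]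
  calc (n : ℝ) ^ k * (n - k).factorial ≤ 3 ^ k * (2 ^ k * (n - l).factorial) := hfac'
    _ = (n - l).factorial * (3 * 2) ^ k := by
        rw [mul_pow]
        ring
    _ = (n - l).factorial * 6 ^ k := by norm_num

theorem pow_le_two_pow_of_mul_log_lt {n k l : ℕ} (h : l * (Nat.log 2 n + 1) < k) :
    n ^ l ≤ 2 ^ k :=
  calc n ^ l ≤ (2 ^ (Nat.log 2 n + 1)) ^ l := by
        gcongr
        exact (Nat.lt_pow_succ_log_self one_lt_two n).le
    _ = 2 ^ (l * (Nat.log 2 n + 1)) := by rw [← pow_mul, mul_comm]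
    _ ≤ 2 ^ k := Nat.pow_le_pow_right two_pos h.le

theorem one_add_div_pow_le_exp {x r : ℝ} (hx : 0 ≤ x) (hr : 0 ≤ r) (k : ℕ) :
    (1 + x / r) ^ k ≤ Real.exp (k * (x / r)) := by
  rw [Real.exp_nat_mul, add_comm]
  gcongr
  exact Real.add_one_le_exp _

theorem sixteen_mul_one_add_pow_lt {n : ℕ} (hn : 0 < n) :
    16 * (1 + 8 / ((n : ℝ) / 6)) ^ n < 2 ^ 81 := by
  have hn₀ : (n : ℝ) ≠ 0 := by exact_mod_cast hn.ne'
  calc 16 * (1 + 8 / ((n : ℝ) / 6)) ^ n ≤ 16 * Real.exp (n * (8 / ((n : ℝ) / 6))) := by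
        gcongr
        exact one_add_div_pow_le_exp (by norm_num) (by positivity) n
    _ = 16 * Real.exp 1 ^ 48 := by
        rw [Real.exp_one_pow]
        congr 2
        field_simp
        norm_num
    _ ≤ 16 * 3 ^ 48 := by
        gcongr
        exact Real.exp_one_lt_three.le
    _ < 2 ^ 81 := by norm_num

end Bounds

section Stability

open Filter Asymptotics Topology

theorem isLittleO_mul_natLog_add_one_sq (l : ℕ) :
    (fun n : ℕ ↦ ((l * (Nat.log 2 n + 1) : ℕ) : ℝ) ^ 2) =o[atTop] fun n : ℕ ↦ (n : ℝ) := by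
  have hO : (fun n : ℕ ↦ ((l * (Nat.log 2 n + 1) : ℕ) : ℝ)) =O[atTop]
      fun n : ℕ ↦ Real.log n := by
    refine IsBigO.of_bound (3 * l) ?_
    filter_upwards [(Real.tendsto_log_atTop.comp tendsto_natCast_atTop_atTop).eventually_ge_atTop 1]
      with n (hn : 1 ≤ Real.log n)
    have hlog : (Nat.log 2 n : ℝ) ≤ 2 * Real.log n := by
      refine (Real.natLog_le_logb n 2).trans ?_
      rw [Real.logb, Nat.cast_ofNat, div_le_iff₀ (Real.log_pos one_lt_two)]
      nlinarith [Real.log_two_gt_d9]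
    rw [Real.norm_natCast, Real.norm_of_nonneg (by linarith)]
    push_cast
    calc (l : ℝ) * (Nat.log 2 n + 1) ≤ l * (2 * Real.log n + Real.log n) := by gcongr
      _ = 3 * l * Real.log n := by ring
  exact (hO.pow 2).trans_isLittleO
    (Real.isLittleO_pow_log_id_atTop.comp_tendsto tendsto_natCast_atTop_atTop)

theorem eventually_one_add_const_div_pow_le_two (x : ℝ) (t : ℕ) :
    ∀ᶠ n : ℕ in atTop, (1 + x / ((n : ℝ) / 6)) ^ t ≤ 2 := by
  have hdiv : Tendsto (fun n : ℕ ↦ x / ((n : ℝ) / 6)) atTop (𝓝 0) :=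
    tendsto_const_nhds.div_atTop (tendsto_natCast_atTop_atTop.atTop_div_const (by norm_num))
  have hpow : Tendsto (fun n : ℕ ↦ (1 + x / ((n : ℝ) / 6)) ^ t) atTop (𝓝 1) := by
    simpa using (hdiv.const_add 1).pow t
  exact hpow.eventually_le_const one_lt_two

theorem eventually_forall_exists_card_filter_le_or_card_le {l : ℕ} (hl : 2 ≤ l) {ε : ℝ}
    (hε : 0 < ε) : ∀ᶠ n : ℕ in atTop, ∀ A : Finset (Perm (Fin n)), IsIntersecting A →
      (∃ i j, #{σ ∈ A | σ i ≠ j} ≤ (n - l).factorial) ∨ (#A : ℝ) ≤ ε * (n - 1).factorial := by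
  -- The spreadness is `n / 6`: as `n ^ k ≤ 3 ^ k * n.descFactorial k`, this leaves a factor
  -- `2 ^ k`, which beats `n ^ l` as soon as `k > l * (Nat.log 2 n + 1)`.
  have hεsq := (isLittleO_mul_natLog_add_one_sq l).bound (half_pos hε)
  have hsq := (isLittleO_mul_natLog_add_one_sq l).bound (show (0 : ℝ) < 1 / 12 by norm_num)
  filter_upwards [hεsq, hsq, eventually_one_add_const_div_pow_le_two 128 81, eventually_ge_atTop l,
    tendsto_natCast_atTop_atTop.eventually_ge_atTop (2 * (1 + ε) / ε)]
    with n hεsq hsq ht' hln hεn A hA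
  set q := l * (Nat.log 2 n + 1)
  rw [Real.norm_of_nonneg (by positivity), Real.norm_natCast] at hεsq hsq
  have hn₀ : (0 : ℝ) < n := by exact_mod_cast (by lia : 0 < n)
  have hq : 2 * (q : ℝ) ≤ n / 6 := by
    have : (q : ℝ) ≤ q ^ 2 := by exact_mod_cast Nat.le_self_pow two_ne_zero q
    linarith
  have happrox := exists_card_filter_apply_ne_le_or_card_le (R := ((n - l).factorial : ℝ)) hA
    (div_pos hn₀ (by norm_num)) (by positivity) hq
    (fun k hqk hkn ↦ by
      rw [Fintype.card_fin] at hkn ⊢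
      exact div_six_pow_mul_factorial_sub_le hkn hln (pow_le_two_pow_of_mul_log_lt hqk))
    (by
      rw [Fintype.card_fin]
      exact sixteen_mul_one_add_pow_lt (by lia)) ht'
  refine happrox.imp (fun ⟨i, j, h⟩ ↦ ⟨i, j, by exact_mod_cast h⟩) fun h ↦ ?_
  have hn : ((n - 1).factorial : ℝ) = (n - 1) * (n - 2).factorial := by
    obtain ⟨m, rfl⟩ := Nat.exists_eq_add_of_le' (hl.trans hln)
    rw [Nat.add_sub_cancel, show m + 2 - 1 = m + 1 from rfl, Nat.factorial_succ]
    push_cast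
    ring
  calc (#A : ℝ) ≤ q ^ 2 * (n - 2).factorial + (n - l).factorial := by rwa [Fintype.card_fin] at h
    _ ≤ q ^ 2 * (n - 2).factorial + (n - 2).factorial := by gcongr
    _ = (q ^ 2 + 1) * (n - 2).factorial := by ring
    _ ≤ (ε * (n - 1)) * (n - 2).factorial := by
        gcongr
        rw [div_le_iff₀ hε] at hεn
        linarith
    _ = ε * (n - 1).factorial := by rw [hn, mul_assoc]

end Stability

section Derangements

variable {α : Type*}

theorem exists_apply_ne_apply {i j : α} {τ₁ τ₂ : Perm α} (hne : τ₁ ≠ τ₂) (h₁ : τ₁ i ≠ j)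
    (h₂ : τ₂ i ≠ j) : ∃ k, k ≠ i ∧ τ₁ k ≠ τ₂ k ∧ τ₁ k ≠ j := by
  have hpull : ∀ x, τ₁ x ≠ τ₂ x → τ₁ (τ₁.symm (τ₂ x)) ≠ τ₂ (τ₁.symm (τ₂ x)) := by
    intro x hx h
    rw [apply_symm_apply] at h
    exact hx ((eq_symm_apply τ₁).1 (τ₂.injective h))
  by_cases hi : τ₁ i = τ₂ i
  · obtain ⟨x, hx⟩ := DFunLike.ne_iff.1 hne
    have hxi : x ≠ i := by
      rintro rfl
      exact hx hi
    by_cases hxj : τ₁ x = j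
    · refine ⟨τ₁.symm (τ₂ x), fun h ↦ hxi (τ₂.injective ?_), hpull x hx, ?_⟩
      · rw [(symm_apply_eq τ₁).1 h, hi]
      · rw [apply_symm_apply, ← hxj]
        exact hx.symm
    · exact ⟨x, hxi, hx, hxj⟩
  · exact ⟨τ₁.symm (τ₂ i), fun h ↦ hi ((symm_apply_eq τ₁).1 h).symm, hpull i hi,
      by rwa [apply_symm_apply]⟩

variable [DecidableEq α]

theorem swap_mul_apply_ne_self {θ : Perm α} (hθ : ∀ x, θ x ≠ x) {u v : α} (hu : θ u ≠ v)
    (hv : θ v ≠ u) (x : α) : (swap u v * θ) x ≠ x := by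
  rw [Perm.mul_apply, ne_eq, swap_apply_eq_iff]
  rcases eq_or_ne x u with rfl | hxu
  · rwa [swap_apply_left]
  rcases eq_or_ne x v with rfl | hxv
  · rwa [swap_apply_right]
  · rw [swap_apply_of_ne_of_ne hxu hxv]
    exact hθ x

theorem swap_mul_ofSubtype_apply_ne_self {p : α → Prop} [DecidablePred p] {ρ : Perm (Subtype p)}
    (hρ : ∀ x, ρ x ≠ x) {i k : α} (hik : i ≠ k) (hp : ∀ x, p x ↔ x ≠ i ∧ x ≠ k) (x : α) :
    (swap i k * ρ.ofSubtype) x ≠ x := by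
  rw [Perm.mul_apply, ne_eq, swap_apply_eq_iff]
  by_cases hx : p x
  · rw [Perm.ofSubtype_apply_of_mem ρ hx, swap_apply_of_ne_of_ne ((hp x).1 hx).1 ((hp x).1 hx).2]
    exact fun h ↦ hρ ⟨x, hx⟩ (Subtype.ext h)
  · rw [Perm.ofSubtype_apply_of_not_mem ρ hx]
    intro h
    grind [swap_apply_left, swap_apply_right]

variable [Fintype α]

theorem card_filter_derangement :
    #{σ : Perm α | ∀ x, σ x ≠ x} = numDerangements (Fintype.card α) := by
  rw [← card_derangements_eq_numDerangements, ← Fintype.card_subtype]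
  rfl

theorem card_filter_derangement_apply_eq_congr {i a b : α} (ha : a ≠ i) (hb : b ≠ i) :
    #{σ : Perm α | (∀ x, σ x ≠ x) ∧ σ i = a} = #{σ : Perm α | (∀ x, σ x ≠ x) ∧ σ i = b} := by
  have hi : swap a b i = i := swap_apply_of_ne_of_ne ha.symm hb.symm
  refine card_equiv (MulAut.conj (swap a b)).toEquiv fun σ ↦ ?_
  simp only [mem_filter_univ, MulEquiv.toEquiv_eq_coe, EquivLike.coe_coe, MulAut.conj_apply,
    swap_inv, Perm.mul_apply, hi, ne_eq, swap_apply_eq_iff, swap_apply_right]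
  rw [(swap a b).forall_congr_left]
  simp only [symm_swap]

theorem card_filter_derangement_apply_eq {i a : α} (ha : a ≠ i) :
    #{σ : Perm α | (∀ x, σ x ≠ x) ∧ σ i = a} =
      numDerangements (Fintype.card α - 1) + numDerangements (Fintype.card α - 2) := by
  have hfib := card_eq_sum_card_fiberwise (s := {σ : Perm α | ∀ x, σ x ≠ x}) (t := univ.erase i)
    (f := fun σ ↦ σ i) fun σ hσ ↦ by simpa using (mem_filter_univ σ).1 hσ i
  have hsum : numDerangements (Fintype.card α) =
      (Fintype.card α - 1) * #{σ : Perm α | (∀ x, σ x ≠ x) ∧ σ i = a} := by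
    rw [← card_filter_derangement, hfib, sum_congr rfl fun b hb ↦ by
        rw [filter_filter, card_filter_derangement_apply_eq_congr (ne_of_mem_erase hb) ha],
      sum_const, card_erase_of_mem (mem_univ _), card_univ, smul_eq_mul]
  have hcard : 1 < Fintype.card α := Fintype.one_lt_card_iff.2 ⟨a, i, ha⟩
  obtain ⟨m, hm⟩ := Nat.exists_eq_add_of_le' hcard
  rw [hm, numDerangements_add_two] at hsum
  rw [hm, add_comm (numDerangements _)]
  exact (Nat.eq_of_mul_eq_mul_left m.succ_pos hsum).symm

theorem card_filter_apply_eq_forall_ne {i j : α} {τ : Perm α} (hτ : τ i ≠ j) :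
    #{σ : Perm α | σ i = j ∧ ∀ x, σ x ≠ τ x} =
      numDerangements (Fintype.card α - 1) + numDerangements (Fintype.card α - 2) := by
  have hj : τ.symm j ≠ i := fun h ↦ hτ ((symm_apply_eq _).1 h).symm
  rw [← card_filter_derangement_apply_eq hj]
  exact card_equiv (Equiv.mulLeft τ⁻¹) fun σ ↦ by simp [Equiv.symm_apply_eq, and_comm]

theorem card_filter_apply_eq (i j : α) :
    #{σ : Perm α | σ i = j} = (Fintype.card α - 1).factorial := by
  simpa using card_filter_eqOn (swap i j) {i}

theorem card_filter_apply_eq_exists_add {i j : α} {τ : Perm α} (hτ : τ i ≠ j) :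
    #{σ : Perm α | σ i = j ∧ ∃ x, σ x = τ x} +
      (numDerangements (Fintype.card α - 1) + numDerangements (Fintype.card α - 2)) =
      (Fintype.card α - 1).factorial := by
  rw [← card_filter_apply_eq i j, ← card_filter_apply_eq_forall_ne hτ,
    ← card_filter_add_card_filter_not (s := {σ : Perm α | σ i = j}) fun σ ↦ ∃ x, σ x = τ x,
    filter_filter, filter_filter]
  simp only [not_exists]

theorem numDerangements_le_card_filter_derangement_apply_eq_apply_eq {i k a b : α} (hik : i ≠ k)
    (hai : a ≠ i) (hbk : b ≠ k) (hab : a ≠ b) :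
    numDerangements (Fintype.card α - 2) ≤
      #{σ : Perm α | (∀ x, σ x ≠ x) ∧ σ i = a ∧ σ k = b} := by
  have hcard : Fintype.card {x // x ∉ ({i, k} : Finset α)} = Fintype.card α - 2 := by
    rw [Fintype.card_subtype_compl, Fintype.card_coe, card_pair hik]
  rw [← hcard, ← card_filter_derangement]
  refine card_le_card_of_injOn (fun ρ ↦ swap k a * (swap i b * (swap i k * ρ.ofSubtype)))
    (fun ρ hρ ↦ ?_) fun ρ _ ρ' _ h ↦
      Perm.ofSubtype_injective (mul_left_cancel (mul_left_cancel (mul_left_cancel h)))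
  -- `swap i k * ρ` exchanges `i` and `k`; the outer swaps turn these two values into `b` and `a`.
  have hρ' : ∀ x, ρ x ≠ x := (mem_filter_univ ρ).1 hρ
  have hθ := swap_mul_ofSubtype_apply_ne_self hρ' hik (by simp)
  have hi : (swap i k * ρ.ofSubtype) i = k := by
    rw [Perm.mul_apply, Perm.ofSubtype_apply_of_not_mem ρ (by simp), swap_apply_left]
  have hk : (swap i k * ρ.ofSubtype) k = i := by
    rw [Perm.mul_apply, Perm.ofSubtype_apply_of_not_mem ρ (by simp), swap_apply_right]
  refine (mem_filter_univ _).2 ?_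
  dsimp only
  generalize swap i k * ρ.ofSubtype = θ at hθ hi hk ⊢
  have hθi : (swap i b * θ) i = k := by
    rw [Perm.mul_apply, hi, swap_apply_of_ne_of_ne hik.symm hbk.symm]
  have hθk : (swap i b * θ) k = b := by rw [Perm.mul_apply, hk, swap_apply_left]
  have hθb : ∀ x, (swap i b * θ) x ≠ x :=
    swap_mul_apply_ne_self hθ (by rwa [hi, ne_comm]) fun h ↦ hbk (θ.injective (h.trans hk.symm))
  refine ⟨swap_mul_apply_ne_self hθb (by rwa [hθk, ne_comm]) ?_, ?_, ?_⟩
  · exact fun h ↦ hai ((swap i b * θ).injective (h.trans hθi.symm))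
  · rw [Perm.mul_apply, hθi, swap_apply_left]
  · rw [Perm.mul_apply, hθk, swap_apply_of_ne_of_ne hbk hab.symm]

theorem numDerangements_le_card_filter_apply_eq_exists_forall_ne {i j : α} {τ₁ τ₂ : Perm α}
    (hne : τ₁ ≠ τ₂) (h₁ : τ₁ i ≠ j) (h₂ : τ₂ i ≠ j) :
    numDerangements (Fintype.card α - 2) ≤
      #{σ : Perm α | σ i = j ∧ (∃ x, σ x = τ₁ x) ∧ ∀ x, σ x ≠ τ₂ x} := by
  obtain ⟨k, hki, hk, hkj⟩ := exists_apply_ne_apply hne h₁ h₂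
  refine (numDerangements_le_card_filter_derangement_apply_eq_apply_eq (a := τ₂.symm j)
    (b := τ₂.symm (τ₁ k)) hki.symm ?_ ?_ fun h ↦ hkj (τ₂.symm.injective h).symm).trans
    (card_le_card_of_injOn (fun σ ↦ τ₂ * σ) (fun σ hσ ↦ ?_) (mul_right_injective τ₂).injOn)
  · exact fun h ↦ h₂ ((symm_apply_eq _).1 h).symm
  · exact fun h ↦ hk ((symm_apply_eq _).1 h)
  · obtain ⟨hσ, hσi, hσk⟩ := (mem_filter_univ σ).1 hσ
    refine (mem_filter_univ _).2 ⟨?_, ⟨k, ?_⟩, fun x h ↦ hσ x (τ₂.injective h)⟩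
    · rw [Perm.mul_apply, hσi, apply_symm_apply]
    · rw [Perm.mul_apply, hσk, apply_symm_apply]

theorem factorial_le_numDerangements_succ {m : ℕ} (hm : 1 ≤ m) :
    m.factorial ≤ numDerangements (m + 1) := by
  induction m, hm using Nat.le_induction with
  | base => decide
  | succ m _ ih =>
    rw [numDerangements_add_two, Nat.factorial_succ]
    gcongr
    exact ih.trans (Nat.le_add_left _ _)

end Derangements

section Extremal

variable {α : Type*} [Fintype α] [DecidableEq α]

/-- The extremal families: the permutations that map `i` to `j` and agree somewhere with `τ`,
together with `τ` itself. The name refers to the analogous families of sets. -/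
def hiltonMilner (i j : α) (τ : Perm α) : Finset (Perm α) :=
  insert τ ({σ | σ i = j ∧ ∃ x, σ x = τ x} : Finset (Perm α))

theorem mem_hiltonMilner {i j : α} {τ σ : Perm α} :
    σ ∈ hiltonMilner i j τ ↔ σ = τ ∨ σ i = j ∧ ∃ x, σ x = τ x := by
  simp [hiltonMilner]

theorem card_hiltonMilner_add {i j : α} {τ : Perm α} (hτ : τ i ≠ j) :
    #(hiltonMilner i j τ) +
      (numDerangements (Fintype.card α - 1) + numDerangements (Fintype.card α - 2)) =
      (Fintype.card α - 1).factorial + 1 := by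
  rw [hiltonMilner, card_insert_of_notMem (by simp [hτ]), ← card_filter_apply_eq_exists_add hτ]
  ring

theorem exists_apply_eq_of_mem_hiltonMilner {i j : α} {τ σ π : Perm α}
    (hσ : σ ∈ hiltonMilner i j τ) (hπ : π ∈ hiltonMilner i j τ) : ∃ x, σ x = π x := by
  rcases mem_hiltonMilner.1 hσ with rfl | ⟨hσi, hσ⟩ <;>
    rcases mem_hiltonMilner.1 hπ with rfl | ⟨hπi, hπ⟩
  · exact ⟨i, rfl⟩
  · exact hπ.imp fun _ ↦ Eq.symm
  · exact hσ
  · exact ⟨i, hσi.trans hπi.symm⟩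

theorem image_hiltonMilner (i j : α) (τ π ρ : Perm α) :
    (hiltonMilner i j τ).image (fun σ ↦ π * σ * ρ) =
      hiltonMilner (ρ.symm i) (π j) (π * τ * ρ) := by
  ext σ
  constructor
  · simp only [mem_image, mem_hiltonMilner]
    rintro ⟨σ, rfl | ⟨hσ, x, hx⟩, rfl⟩
    · exact Or.inl rfl
    · exact Or.inr ⟨by simp [hσ], ρ.symm x, by simp [hx]⟩
  · intro hσ
    refine mem_image.2 ⟨π⁻¹ * σ * ρ⁻¹, mem_hiltonMilner.2 ?_, by group⟩
    rcases mem_hiltonMilner.1 hσ with rfl | ⟨hσ, x, hx⟩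
    · exact Or.inl (by group)
    · exact Or.inr ⟨by simp [hσ], ρ x, by simp [hx]⟩

theorem exists_image_hiltonMilner_eq {i j i' j' : α} {τ τ' : Perm α} (h : τ i ≠ j)
    (h' : τ' i' ≠ j') : ∃ π ρ : Perm α,
      hiltonMilner i j τ = (hiltonMilner i' j' τ').image fun σ ↦ π * σ * ρ := by
  obtain ⟨ρ, hi, hj⟩ : ∃ ρ : Perm α, ρ i = i' ∧ ρ (τ.symm j) = τ'.symm j' :=
    MulAction.is_two_pretransitive_iff.1 (Perm.isMultiplyPretransitive α 2)
      (fun hij ↦ h ((eq_symm_apply τ).1 hij)) fun hij ↦ h' ((eq_symm_apply τ').1 hij)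
  refine ⟨τ * ρ⁻¹ * τ'⁻¹, ρ, ?_⟩
  rw [image_hiltonMilner]
  congr 1
  · rw [← hi, symm_apply_apply]
  · simp [← hj]
  · group

theorem card_filter_apply_eq_add_le {A : Finset (Perm α)}
    (hA : ∀ σ ∈ A, ∀ π ∈ A, ∃ x, σ x = π x) {i j : α} {τ₁ τ₂ : Perm α} (hτ₁ : τ₁ ∈ A)
    (hτ₂ : τ₂ ∈ A) (hne : τ₁ ≠ τ₂) (h₁ : τ₁ i ≠ j) (h₂ : τ₂ i ≠ j) :
    #{σ ∈ A | σ i = j} + numDerangements (Fintype.card α - 2) +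
      (numDerangements (Fintype.card α - 1) + numDerangements (Fintype.card α - 2)) ≤
      (Fintype.card α - 1).factorial := by
  rw [← card_filter_apply_eq_exists_add h₁, ← card_filter_add_card_filter_not
    (s := {σ : Perm α | σ i = j ∧ ∃ x, σ x = τ₁ x}) fun σ ↦ ∃ x, σ x = τ₂ x]
  gcongr
  · intro σ hσ
    obtain ⟨hσA, hσi⟩ := mem_filter.1 hσ
    exact mem_filter.2 ⟨(mem_filter_univ σ).2 ⟨hσi, hA σ hσA τ₁ hτ₁⟩, hA σ hσA τ₂ hτ₂⟩
  · simpa only [filter_filter, not_exists, and_assoc] using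
      numDerangements_le_card_filter_apply_eq_exists_forall_ne hne h₁ h₂

theorem IsDoubleTranslate.card_eq {n : ℕ} {A F : Finset (Perm (Fin n))}
    (h : IsDoubleTranslate A F) : #A = #F := by
  obtain ⟨π, ρ, rfl⟩ := h
  exact card_image_of_injective _ fun σ σ' h ↦ mul_left_cancel (mul_right_cancel h)

theorem familyC_eq_hiltonMilner {n : ℕ} (hn : 2 ≤ n) :
    familyC n hn =
      hiltonMilner ⟨0, by lia⟩ ⟨0, by lia⟩ (swap ⟨0, by lia⟩ ⟨1, by lia⟩) := by
  ext σ
  rw [mem_hiltonMilner, familyC, mem_union, mem_singleton, or_comm, mem_filter_univ]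
  refine or_congr_right (and_congr_right fun h₀ ↦ exists_congr fun x ↦ ?_)
  rcases eq_or_ne x ⟨0, by lia⟩ with rfl | hx₀
  · simp [h₀]
  rcases eq_or_ne x ⟨1, by lia⟩ with rfl | hx₁
  · rw [swap_apply_right, ← h₀]
    simp
  · rw [swap_apply_of_ne_of_ne hx₀ hx₁, and_iff_right]
    rw [ne_eq, Fin.ext_iff] at hx₀ hx₁
    lia

theorem isIntersecting_familyC {n : ℕ} (hn : 2 ≤ n) : IsIntersecting (familyC n hn) := by
  rw [familyC_eq_hiltonMilner]
  exact fun σ hσ π hπ ↦ exists_apply_eq_of_mem_hiltonMilner hσ hπ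

theorem card_familyC_add {n : ℕ} (hn : 2 ≤ n) :
    #(familyC n hn) + (numDerangements (n - 1) + numDerangements (n - 2)) =
      (n - 1).factorial + 1 := by
  simpa only [familyC_eq_hiltonMilner, Fintype.card_fin] using
    card_hiltonMilner_add (τ := swap (⟨0, by lia⟩ : Fin n) ⟨1, by lia⟩) (i := ⟨0, by lia⟩)
      (j := ⟨0, by lia⟩) (by simp [Fin.ext_iff])

theorem isDoubleTranslate_hiltonMilner {n : ℕ} (hn : 2 ≤ n) {i j : Fin n} {τ : Perm (Fin n)}
    (hτ : τ i ≠ j) : IsDoubleTranslate (hiltonMilner i j τ) (familyC n hn) := by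
  rw [familyC_eq_hiltonMilner]
  exact exists_image_hiltonMilner_eq hτ (by simp)

theorem not_isCentred_familyC {n : ℕ} (hn : 4 ≤ n) : ¬ IsCentred (familyC n (by lia)) := by
  rintro ⟨i, j, h⟩
  have hfix : ∀ σ : Perm (Fin n), σ ⟨0, by lia⟩ = ⟨0, by lia⟩ →
      (∃ x : Fin n, 1 < x.val ∧ σ x = x) → σ i = j := fun σ h₀ hx ↦
    h σ (mem_union_left _ ((mem_filter_univ σ).2 ⟨h₀, hx⟩))
  obtain rfl : i = j := hfix 1 rfl ⟨⟨2, by lia⟩, Nat.one_lt_two, rfl⟩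
  have hswap := h _ (mem_union_right _ (mem_singleton_self _))
  have hi₀ : i ≠ ⟨0, by lia⟩ := by
    rintro rfl
    simp at hswap
  have hi₁ : i ≠ ⟨1, by lia⟩ := by
    rintro rfl
    simp at hswap
  obtain ⟨x, hx, hxi⟩ : ∃ x : Fin n, 1 < x.val ∧ x ≠ i := by
    rcases eq_or_ne i ⟨2, by lia⟩ with rfl | hi₂
    · exact ⟨⟨3, by lia⟩, by simp, by simp⟩
    · exact ⟨⟨2, by lia⟩, by simp, hi₂.symm⟩
  have hx₁ : x ≠ ⟨1, by lia⟩ := by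
    rintro rfl
    simp at hx
  have hi := hfix (swap ⟨1, by lia⟩ i) (swap_apply_of_ne_of_ne (by simp) hi₀.symm)
    ⟨x, hx, swap_apply_of_ne_of_ne hx₁ hxi⟩
  rw [swap_apply_right] at hi
  exact hi₁ hi.symm

theorem IsIntersecting.card_lt_card_familyC {n : ℕ} (hn : 4 ≤ n) {A : Finset (Perm (Fin n))}
    (hA : IsIntersecting A) {i j : Fin n} (hlt : 1 < #{σ ∈ A | σ i ≠ j})
    (hle : #{σ ∈ A | σ i ≠ j} ≤ (n - 3).factorial) : #A < #(familyC n (by lia)) := by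
  obtain ⟨τ₁, hτ₁, τ₂, hτ₂, hne⟩ := one_lt_card.1 hlt
  rw [mem_filter] at hτ₁ hτ₂
  have hcount := card_filter_apply_eq_add_le hA hτ₁.1 hτ₂.1 hne hτ₁.2 hτ₂.2
  rw [Fintype.card_fin] at hcount
  have hder : (n - 3).factorial ≤ numDerangements (n - 2) := by
    rw [show n - 2 = n - 3 + 1 by lia]
    exact factorial_le_numDerangements_succ (by lia)
  have hsplit := card_filter_add_card_filter_not (s := A) fun σ ↦ σ i = j
  have hfamilyC := card_familyC_add (n := n) (by lia)
  lia

theorem IsIntersecting.card_le_card_familyC {n : ℕ} (hn : 4 ≤ n) {A : Finset (Perm (Fin n))}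
    (hA : IsIntersecting A) (hA' : ¬ IsCentred A) {i j : Fin n}
    (hle : #{σ ∈ A | σ i ≠ j} ≤ (n - 3).factorial) :
    #A ≤ #(familyC n (by lia)) ∧
      (#A = #(familyC n (by lia)) → IsDoubleTranslate A (familyC n (by lia))) := by
  rcases lt_or_ge 1 #{σ ∈ A | σ i ≠ j} with hlt | hone
  · have := hA.card_lt_card_familyC hn hlt hle
    exact ⟨this.le, fun h ↦ absurd h this.ne⟩
  obtain ⟨τ, hτA, hτ⟩ : ∃ τ ∈ A, τ i ≠ j := by
    by_contra! h
    exact hA' ⟨i, j, h⟩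
  have hsub : A ⊆ hiltonMilner i j τ := by
    refine fun σ hσ ↦ mem_hiltonMilner.2 ?_
    by_cases hσi : σ i = j
    · exact Or.inr ⟨hσi, hA σ hσ τ hτA⟩
    · exact Or.inl (card_le_one.1 hone σ (mem_filter.2 ⟨hσ, hσi⟩) τ (mem_filter.2 ⟨hτA, hτ⟩))
  have htrans := isDoubleTranslate_hiltonMilner (by lia) hτ
  refine ⟨(card_le_card hsub).trans htrans.card_eq.le, fun h ↦ ?_⟩
  rwa [eq_of_subset_of_card_le hsub (htrans.card_eq.trans h.symm).le]

end Extremal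

section Asymptotics

open Filter Topology

theorem card_familyC_div_factorial (m : ℕ) :
    (#(familyC (m + 2) (Nat.le_add_left 2 m)) : ℝ) / (m + 1).factorial =
      1 - numDerangements (m + 1) / (m + 1).factorial -
        numDerangements m / m.factorial * (1 / (m + 1)) + 1 / (m + 1).factorial := by
  have hcard : (#(familyC (m + 2) (Nat.le_add_left 2 m)) : ℝ) +
      (numDerangements (m + 1) + numDerangements m) = (m + 1).factorial + 1 := by
    exact_mod_cast card_familyC_add (Nat.le_add_left 2 m)
  have hfac : ((m + 1).factorial : ℝ) = (m + 1) * m.factorial := by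
    exact_mod_cast Nat.factorial_succ m
  have hm : (m : ℝ) + 1 ≠ 0 := by positivity
  rw [eq_sub_of_add_eq hcard, hfac]
  field_simp
  ring

theorem tendsto_card_familyC_div_factorial :
    Tendsto (fun m : ℕ ↦ (#(familyC (m + 2) (Nat.le_add_left 2 m)) : ℝ) / (m + 1).factorial)
      atTop (𝓝 (1 - 1 / Real.exp 1)) := by
  simp only [card_familyC_div_factorial]
  have hder := numDerangements_tendsto_inv_e
  have hinv := tendsto_one_div_add_atTop_nhds_zero_nat (𝕜 := ℝ)
  have hfac : Tendsto (fun m : ℕ ↦ 1 / ((m + 1).factorial : ℝ)) atTop (𝓝 0) := by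
    refine squeeze_zero (fun m ↦ by positivity) (fun m ↦ ?_) hinv
    gcongr
    exact_mod_cast Nat.self_le_factorial (m + 1)
  simpa [Function.comp_def, Real.exp_neg] using
    (((hder.comp (tendsto_add_atTop_nat 1)).const_sub 1).sub (hder.mul hinv)).add hfac

theorem eventually_half_mul_factorial_lt_card_familyC :
    ∀ᶠ n : ℕ in atTop, ∀ hn : 2 ≤ n, (1 / 2 : ℝ) * (n - 1).factorial < #(familyC n hn) := by
  have hlt : (1 / 2 : ℝ) < 1 - 1 / Real.exp 1 := by
    have hexp : (2 : ℝ) < Real.exp 1 := lt_trans (by norm_num) Real.exp_one_gt_d9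
    have := one_div_lt_one_div_of_lt two_pos hexp
    linarith
  have hev := tendsto_card_familyC_div_factorial.eventually_const_lt hlt
  filter_upwards [(tendsto_sub_atTop_nat 2).eventually hev] with n h hn
  obtain ⟨m, rfl⟩ := Nat.exists_eq_add_of_le' hn
  exact (lt_div_iff₀ (by positivity)).1 h

end Asymptotics

end CameronKu

theorem mainTheorem1 :
    (∃ N : ℕ, ∀ (n : ℕ) (hn : 2 ≤ n), N ≤ n →
      (CameronKu.IsIntersecting (CameronKu.familyC n hn) ∧
        ¬ CameronKu.IsCentred (CameronKu.familyC n hn)) ∧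
      ((CameronKu.familyC n hn).card : ℤ) =
        (Nat.factorial (n - 1) : ℤ) - (numDerangements (n - 1) : ℤ)
          - (numDerangements (n - 2) : ℤ) + 1 ∧
      ∀ A : Finset (Equiv.Perm (Fin n)),
        CameronKu.IsIntersecting A → ¬ CameronKu.IsCentred A →
          A.card ≤ (CameronKu.familyC n hn).card ∧
          (A.card = (CameronKu.familyC n hn).card ↔
            CameronKu.IsDoubleTranslate A (CameronKu.familyC n hn))) ∧
    Filter.Tendsto
      (fun m : ℕ => ((CameronKu.familyC (m + 2) (Nat.le_add_left 2 m)).card : ℝ) /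
        (Nat.factorial (m + 1) : ℝ))
      Filter.atTop (nhds (1 - 1 / Real.exp 1)) := by
  refine ⟨?_, CameronKu.tendsto_card_familyC_div_factorial⟩
  obtain ⟨N, hN⟩ := Filter.eventually_atTop.1
    ((CameronKu.eventually_forall_exists_card_filter_le_or_card_le (l := 3) (by norm_num)
      one_half_pos).and
      (CameronKu.eventually_half_mul_factorial_lt_card_familyC.and (Filter.eventually_ge_atTop 4)))
  refine ⟨N, fun n hn hNn ↦ ?_⟩
  obtain ⟨hstab, hhalf, hn₄⟩ := hN n hNn
  refine ⟨⟨CameronKu.isIntersecting_familyC hn, CameronKu.not_isCentred_familyC hn₄⟩, ?_,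
    fun A hA hA' ↦ ?_⟩
  · have := CameronKu.card_familyC_add hn
    lia
  suffices h : A.card ≤ (CameronKu.familyC n hn).card ∧
      (A.card = (CameronKu.familyC n hn).card →
        CameronKu.IsDoubleTranslate A (CameronKu.familyC n hn)) from
    ⟨h.1, h.2, CameronKu.IsDoubleTranslate.card_eq⟩
  rcases hstab A hA with ⟨i, j, hle⟩ | hsmall
  · exact hA.card_le_card_familyC hn₄ hA' hle
  · have hlt : A.card < (CameronKu.familyC n hn).card := by
      exact_mod_cast hsmall.trans_lt (hhalf hn)
    exact ⟨hlt.le, fun h ↦ absurd h hlt.ne⟩
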